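/- Let $R$ be a finite commutative local ring and let $\mathrm{Aff}(R)$ be the affine monoid of $R$, that is, the monoid of all mappings $R\to R$ of the form $x\mapsto ax+b$ with $a,b\in R$, under composition. For a finite dimensional algebra $A$ over an algebraically closed field $\mathbb K$, the (Gabriel) quiver $Q(A)$ is the directed graph whose vertices are the isomorphism classes of simple left $A$-modules and in which the number of arrows from $[S]$ to $[S']$ is $\dim_{\mathbb K}\mathrm{Ext}^1_A(S,S')$. Then there are no arrows in $Q(\mathbb C\mathrm{Aff}(R))$ ending at the trivial module, i.e. at the class of the one-dimensional module $\mathbb C$ on which every element of $\mathrm{Aff}(R)$ acts as the identity. -/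

import Mathlib

open CategoryTheory

universe t u

/-! ### The Gabriel quiver of an algebra -/

section GabrielQuiver

variable (K : Type t) [Field K] (A : Type u) [Ring A] [Algebra K A]

/-- Simple left `A`-modules, with isomorphic modules identified. Every simple module is a quotient
of `A`, so all simple modules are isomorphic to one in the universe of `A`. -/
instance simpleModuleSetoid : Setoid {S : ModuleCat.{u} A // IsSimpleModule A S} where
  r S T := Nonempty (S.1 ≅ T.1)
  iseqv := ⟨fun S => ⟨Iso.refl S.1⟩, fun ⟨i⟩ => ⟨i.symm⟩, fun ⟨i⟩ ⟨j⟩ => ⟨i.trans j⟩⟩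

/-- The vertex set of the Gabriel quiver of the `K`-algebra `A`: the set of isomorphism classes of
simple left `A`-modules. (The field `K` is recorded because the arrows depend on it.) -/
@[nolint unusedArguments]
def GabrielQuiver (K : Type t) [Field K] (A : Type u) [Ring A] [Algebra K A] : Type (u + 1) :=
  Quotient (simpleModuleSetoid A)

namespace GabrielQuiver

variable {A}

/-- The vertex `[S]` of a simple module `S`. -/
def mk (S : ModuleCat.{u} A) (hS : IsSimpleModule A S) : GabrielQuiver K A :=
  Quotient.mk _ ⟨S, hS⟩

/-- The dimension over `K` of `Ext¹_A(S, T)`. -/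
noncomputable def extDim (S T : ModuleCat.{u} A) : Cardinal.{u} :=
  Module.rank K (Abelian.Ext.{u} S T 1)

theorem extDim_le {S S' T T' : ModuleCat.{u} A} (i : S ≅ S') (j : T ≅ T') :
    extDim K S T ≤ extDim K S' T' := by
  let f : Abelian.Ext.{u} S T 1 →ₗ[K] Abelian.Ext.{u} S' T' 1 :=
    (Abelian.Ext.precompOfLinear (Abelian.Ext.mk₀ i.inv) K T' (zero_add 1)).comp
      (Abelian.Ext.postcompOfLinear (Abelian.Ext.mk₀ j.hom) K S (add_zero 1))
  refine LinearMap.rank_le_of_injective f fun x y h => ?_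
  have key : ∀ z, (Abelian.Ext.mk₀ i.hom).comp ((f z).comp (Abelian.Ext.mk₀ j.inv) (add_zero 1))
      (zero_add 1) = z := by
    intro z
    simp [f]
  rw [← key x, ← key y, h]

theorem extDim_congr {S S' T T' : ModuleCat.{u} A} (i : S ≅ S') (j : T ≅ T') :
    extDim K S T = extDim K S' T' :=
  le_antisymm (extDim_le K i j) (extDim_le K i.symm j.symm)

variable {K}

/-- The number of arrows from `[S]` to `[T]` is `dim_K Ext¹_A(S, T)`. -/
noncomputable def numArrows (s t : GabrielQuiver K A) : Cardinal.{u} :=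
  Quotient.liftOn₂ s t (fun S T => extDim K S.1 T.1)
    (fun _ _ _ _ ⟨i⟩ ⟨j⟩ => extDim_congr K i j)

/-- The Gabriel quiver: the arrows from `s` to `t` form a set with `numArrows s t` elements. -/
noncomputable instance : Quiver.{u} (GabrielQuiver K A) where
  Hom s t := (numArrows s t).out

end GabrielQuiver

end GabrielQuiver

/-! ### The affine monoid and the trivial module -/

/-- The affine monoid of `R`: all mappings `x ↦ a * x + b` on `R`, under composition
(multiplication in `Function.End R` is composition of maps). -/
def AffineMonoid (R : Type u) [CommRing R] : Submonoid (Function.End R) where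
  carrier := {f | ∃ a b : R, ∀ x, f x = a * x + b}
  one_mem' := ⟨1, 0, fun x => by change x = 1 * x + 0; ring⟩
  mul_mem' := by
    rintro f g ⟨a, b, hf⟩ ⟨c, d, hg⟩
    refine ⟨a * c, a * d + b, fun x => ?_⟩
    change f (g x) = _
    rw [hg, hf]
    ring

section TrivialModule

variable (K : Type t) [Field K] (M : Type u) [Monoid M]

/-- The trivial `K[M]`-module: the one-dimensional space `K` (lifted to the universe of `K[M]`),
on which every element of `M` acts as the identity. -/
noncomputable abbrev trivialModule : ModuleCat.{max t u} (MonoidAlgebra K M) :=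
  ModuleCat.of (MonoidAlgebra K M)
    (Representation.trivial K M (ULift.{max t u} K)).asModule

theorem isSimpleModule_trivialModule : IsSimpleModule (MonoidAlgebra K M) (trivialModule K M) := by
  let ρ := Representation.trivial K M (ULift.{max t u} K)
  have h1 : Module.finrank K ρ.asModule = 1 := by
    rw [ρ.asModuleEquiv.finrank_eq]
    simp
  have h2 : IsSimpleModule K ρ.asModule := isSimpleModule_iff_finrank_eq_one.mpr h1
  change IsSimpleModule (MonoidAlgebra K M) ρ.asModule
  have : Nontrivial ρ.asModule := IsSimpleModule.nontrivial K _
  refine (isSimpleModule_iff _ _).mpr ⟨fun p => ?_⟩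
  rcases eq_bot_or_eq_top (p.restrictScalars K) with h | h
  · exact Or.inl ((Submodule.restrictScalars_eq_bot_iff K _ _).mp h)
  · exact Or.inr ((Submodule.restrictScalars_eq_top_iff K _ _).mp h)

/-- The vertex of the Gabriel quiver of `K[M]` given by the trivial module. -/
noncomputable def trivialVertex : GabrielQuiver K (MonoidAlgebra K M) :=
  GabrielQuiver.mk K (trivialModule K M) (isSimpleModule_trivialModule K M)

end TrivialModule

/-! The constant map `0` is a left zero `z` of the affine monoid: `z * m = z`. So a `K`-linear
extension of a homomorphism into the trivial module becomes `K[M]`-linear once precomposed with `z`.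
By Baer's criterion the trivial module is injective, and `Ext¹` into it vanishes. -/

section LeftZero

variable (K : Type t) [Field K] (M : Type u) [Monoid M]

theorem of_smul_trivialModule (m : M) (q : trivialModule K M) :
    MonoidAlgebra.of K M m • q = q := by
  let ρ := Representation.trivial K M (ULift.{max t u} K)
  change MonoidAlgebra.of K M m • (q : ρ.asModule) = q
  apply ρ.asModuleEquiv.injective
  rw [Representation.asModuleEquiv_map_smul]
  simp [ρ]

/-- If `z` is a left zero of `M`, a linear functional `ψ` on a `K[M]`-module becomes `M`-invariant
after precomposition with `z`; this extends homomorphisms into the trivial module. -/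
theorem baer_trivialModule {z : M} (hz : ∀ m, z * m = z) :
    Module.Baer (MonoidAlgebra K M) (trivialModule K M) := by
  let Q := (Representation.trivial K M (ULift.{max t u} K)).asModule
  change Module.Baer (MonoidAlgebra K M) Q
  have hQ : ∀ (m : M) (q : Q), MonoidAlgebra.of K M m • q = q := of_smul_trivialModule K M
  intro I g
  -- Over a field, `g` extends from the left ideal to all of `K[M]`, but only `K`-linearly.
  obtain ⟨ψ, hψ⟩ := LinearMap.exists_extend (p := I.restrictScalars K) (g.restrictScalars K)
  have hψ' : ∀ x (hx : x ∈ I), ψ x = g ⟨x, hx⟩ := fun x hx =>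
    LinearMap.congr_fun hψ (⟨x, hx⟩ : I.restrictScalars K)
  let ζ := MonoidAlgebra.of K M z
  have hlin : ∀ a x : MonoidAlgebra K M, ψ (ζ * (a * x)) = a • ψ (ζ * x) := by
    intro a x
    induction a using MonoidAlgebra.induction_on with
    | of m => rw [hQ, ← mul_assoc, ← map_mul, hz]
    | add a b ha hb => rw [add_mul, mul_add, map_add, ha, hb, add_smul]
    | smul r a ha => rw [smul_mul_assoc, mul_smul_comm, map_smul, ha, smul_assoc]
  refine ⟨{ toFun := fun x => ψ (ζ * x)
            map_add' := fun x y => by rw [mul_add, map_add]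
            map_smul' := hlin }, fun x hx => ?_⟩
  change ψ (ζ * x) = g ⟨x, hx⟩
  -- Precomposing with `z` does not change `g` on `I`: `g (ζ * x) = ζ • g x = g x`, since `z` acts
  -- trivially.
  rw [hψ' _ (I.mul_mem_left ζ hx), ← hQ z (g ⟨x, hx⟩), ← map_smul]
  rfl

/-- The trivial module of a monoid with a left zero is injective. -/
theorem injective_trivialModule {z : M} (hz : ∀ m, z * m = z) :
    Injective (trivialModule K M) :=
  have := (baer_trivialModule K M hz).injective
  Module.injective_object_of_injective_module _ _

end LeftZero

theorem GabrielQuiver.isEmpty_hom_mk_of_injective {K : Type t} [Field K] {A : Type u} [Ring A]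
    [Algebra K A] (s : GabrielQuiver K A) (T : ModuleCat.{u} A) (hT : IsSimpleModule A T)
    [Injective T] : IsEmpty (s ⟶ GabrielQuiver.mk K T hT) := by
  induction s using Quotient.inductionOn with
  | h S =>
    have : Subsingleton (Abelian.Ext.{u} S.1 T 1) :=
      subsingleton_of_forall_eq 0 fun x => x.eq_zero_of_injective
    -- The arrows form a type of cardinality `dim Ext¹`, so rank zero makes it empty.
    change IsEmpty (Module.rank K (Abelian.Ext.{u} S.1 T 1)).out
    rw [rank_subsingleton', ← Cardinal.mk_eq_zero_iff, Cardinal.mk_out]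

/-- The constant map `0` in the affine monoid. -/
def AffineMonoid.zeroMap (R : Type u) [CommRing R] : AffineMonoid R :=
  ⟨fun _ => 0, 0, 0, fun _ => by simp⟩

theorem AffineMonoid.zeroMap_mul (R : Type u) [CommRing R] (m : AffineMonoid R) :
    zeroMap R * m = zeroMap R := rfl

theorem proposition3p1 (R : Type u) [CommRing R] [IsLocalRing R] [Finite R]
    (s : GabrielQuiver ℂ (MonoidAlgebra ℂ (AffineMonoid R))) :
    IsEmpty (s ⟶ trivialVertex ℂ (AffineMonoid R)) :=
  have := injective_trivialModule ℂ (AffineMonoid R) (AffineMonoid.zeroMap_mul R)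
  s.isEmpty_hom_mk_of_injective _ _
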